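/- Let $d\ge 1$, let $\rho$ be the Euclidean distance and $dx$ Lebesgue measure on $\mathbb{R}^d$, and let $X_1,X_2,\dots$ be i.i.d. random vectors in $\mathbb{R}^d$ having a probability density $f$. Put $H=-\int_{\mathbb{R}^d} f(x)\log f(x)\,dx$, $S(f)=\{x: f(x)>0\}$, $V_d=\pi^{d/2}/\Gamma(d/2+1)$, $\gamma=-\int_0^\infty e^{-t}\log t\,dt$. For $N\ge 2$ let $\rho_i=\min_{j\ne i,\ 1\le j\le N}\rho(X_i,X_j)$, $1\le i\le N$, and let $$H_N = d\log\big((\rho_1\cdots\rho_N)^{1/N}\big)+\log V_d+\gamma+\log(N-1)$$ be the Kozachenko–Leonenko estimate. Let $G(t)=0$ for $0\le t<1$ and $G(t)=t\log t$ for $t\ge 1$; for $r>0$ let $I_f(x,r)=\frac{1}{r^dV_d}\int_{\{y:\rho(x,y)\le r\}}f(y)\,dy$, and for $R>0$ let $M_f(x,R)=\sup_{0<r\le R}I_f(x,r)$, $m_f(x,R)=\inf_{0<r\le R}I_f(x,r)$. Consider the functionals with values in $[0,\infty]$ $$K_f(\varepsilon)=\int_{\mathbb{R}^d}\Big(\int_{\mathbb{R}^d}G(|\log\rho(x,y)|)f(y)\,dy\Big)^{1+\varepsilon}f(x)\,dx,$$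 $$Q_f(\varepsilon,R)=\int_{\mathbb{R}^d}M_f(x,R)^{\varepsilon}f(x)\,dx,\qquad T_f(\varepsilon,R)=\int_{\mathbb{R}^d}m_f(x,R)^{-\varepsilon}f(x)\,dx,$$ and the conditions - (A): $\int_{\mathbb{R}^d}\int_{\mathbb{R}^d}|\log\rho(x,y)|^p f(x)f(y)\,dx\,dy<\infty$ for some $p>1$; - (B): some version of $f$ satisfies $f(x)\le M$ for all $x\in\mathbb{R}^d$, for some $M>0$; - (C1): some version of $f$ satisfies $f(x)\ge m$ for all $x\in S(f)$, for some $m>0$. Suppose that 1. $K_f(\varepsilon_0)<\infty$ for some $\varepsilon_0>0$, or (A) holds; and 2. $Q_f(\varepsilon_1,R_1)<\infty$ for some $\varepsilon_1,R_1>0$, or (B) holds; and 3. $T_f(\varepsilon_2,R_2)<\infty$ for some $\varepsilon_2,R_2>0$, or (C1) holds. Then $f\log f$ is integrable, $H_N$ is integrable for every $N\ge 2$, and $\mathsf{E}H_N\to H$ as $N\to\infty$. Moreover, the same conclusion holds if (B) and (C1) are satisfied and $f$ has a version with bounded support $S(f)$. -/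

import Mathlib

noncomputable section

namespace KL

/-- The Euclidean space of dimension `d`, with its Euclidean distance and Lebesgue measure. -/
abbrev E (d : ℕ) : Type := EuclideanSpace ℝ (Fin d)

/-- `f` is a probability density with respect to Lebesgue measure. -/
structure IsProbDensity {d : ℕ} (f : E d → ℝ) : Prop where
  measurable : Measurable f
  nonneg : ∀ x, 0 ≤ f x
  lintegral_eq_one : ∫⁻ x, ENNReal.ofReal (f x) = 1

/-- The probability law with density `f`. -/
def law {d : ℕ} (f : E d → ℝ) : MeasureTheory.Measure (E d) :=
  MeasureTheory.volume.withDensity (fun x => ENNReal.ofReal (f x))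

/-- `g` is a version of `f`: they agree Lebesgue-almost everywhere. -/
def IsVersion {d : ℕ} (g f : E d → ℝ) : Prop :=
  ∀ᵐ x ∂(MeasureTheory.volume : MeasureTheory.Measure (E d)), g x = f x

/-- The support `S(f) = {x | f x > 0}` (no closure is taken). -/
def supp {d : ℕ} (f : E d → ℝ) : Set (E d) := {x | 0 < f x}

/-- The differential entropy `H(f) = - ∫ f log f`. -/
def entropy {d : ℕ} (f : E d → ℝ) : ℝ := -∫ x, f x * Real.log (f x)

/-- The volume of the unit ball, `V_d = π ^ (d / 2) / Γ (d / 2 + 1)`. -/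
def unitBallVol (d : ℕ) : ℝ := Real.pi ^ ((d : ℝ) / 2) / Real.Gamma ((d : ℝ) / 2 + 1)

/-- The Euler constant `γ = - ∫_{(0, ∞)} e ^ (-t) log t dt`. -/
def eulerConst : ℝ := -∫ t in Set.Ioi (0 : ℝ), Real.exp (-t) * Real.log t

/-- The distance from the `i`-th sample point to its nearest neighbour among the other sample
points. For `2 ≤ N` this infimum runs over a finite nonempty index type, so it is a minimum. -/
def nnDist {d N : ℕ} (x : Fin N → E d) (i : Fin N) : ℝ :=
  ⨅ j : {j : Fin N // j ≠ i}, dist (x i) (x j)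

/-- The geometric mean of the nearest neighbour distances. -/
def meanDist {d N : ℕ} (x : Fin N → E d) : ℝ := (∏ i, nnDist x i) ^ ((1 : ℝ) / (N : ℝ))

/-- The Kozachenko-Leonenko entropy estimate computed from `N` sample points. -/
def estimate {d N : ℕ} (x : Fin N → E d) : ℝ :=
  (d : ℝ) * Real.log (meanDist x) + Real.log (unitBallVol d) + eulerConst
    + Real.log ((N : ℝ) - 1)

/-- The statistic `H_N`, computed from the first `N` terms of a sequence of random vectors. -/
def estimator {d : ℕ} {Ω : Type*} (X : ℕ → Ω → E d) (N : ℕ) (ω : Ω) : ℝ :=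
  estimate (fun i : Fin N => X i ω)

/-- `G t = 0` for `t < 1` and `G t = t log t` for `1 ≤ t`. -/
def G (t : ℝ) : ℝ := if t < 1 then 0 else t * Real.log t

/-- The average `I_f(x, r)` of `f` over the closed ball of centre `x` and radius `r`. -/
def ballAvg {d : ℕ} (f : E d → ℝ) (x : E d) (r : ℝ) : ENNReal :=
  (∫⁻ y in Metric.closedBall x r, ENNReal.ofReal (f y)) / ENNReal.ofReal (r ^ d * unitBallVol d)

/-- `M_f(x, R)`, the supremum of the averages over radii `0 < r ≤ R`. -/
def maxAvg {d : ℕ} (f : E d → ℝ) (x : E d) (R : ℝ) : ENNReal :=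
  ⨆ r ∈ Set.Ioc (0 : ℝ) R, ballAvg f x r

/-- `m_f(x, R)`, the infimum of the averages over radii `0 < r ≤ R`. -/
def minAvg {d : ℕ} (f : E d → ℝ) (x : E d) (R : ℝ) : ENNReal :=
  ⨅ r ∈ Set.Ioc (0 : ℝ) R, ballAvg f x r

/-- The functional `K_f(ε)`. The value of the inner integrand at `y = x` is irrelevant for
`0 < d`, points being Lebesgue-null. -/
def K {d : ℕ} (f : E d → ℝ) (ε : ℝ) : ENNReal :=
  ∫⁻ x : E d, (∫⁻ y : E d, ENNReal.ofReal (G |Real.log (dist x y)|) * ENNReal.ofReal (f y))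
    ^ (1 + ε) * ENNReal.ofReal (f x)

/-- The functional `Q_f(ε, R)`. -/
def Q {d : ℕ} (f : E d → ℝ) (ε R : ℝ) : ENNReal :=
  ∫⁻ x : E d, maxAvg f x R ^ ε * ENNReal.ofReal (f x)

/-- The functional `T_f(ε, R)`; in `ENNReal`, `0 ^ (-ε) = ⊤` for `0 < ε`, and `⊤ * 0 = 0`. -/
def T {d : ℕ} (f : E d → ℝ) (ε R : ℝ) : ENNReal :=
  ∫⁻ x : E d, minAvg f x R ^ (-ε) * ENNReal.ofReal (f x)

/-- `K_f(ε₀)` is finite for some `ε₀ > 0`. -/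
def FiniteK {d : ℕ} (f : E d → ℝ) : Prop := ∃ ε : ℝ, 0 < ε ∧ K f ε < ⊤

/-- `Q_f(ε₁, R₁)` is finite for some `ε₁ > 0`, `R₁ > 0`. -/
def FiniteQ {d : ℕ} (f : E d → ℝ) : Prop := ∃ ε R : ℝ, 0 < ε ∧ 0 < R ∧ Q f ε R < ⊤

/-- `T_f(ε₂, R₂)` is finite for some `ε₂ > 0`, `R₂ > 0`. -/
def FiniteT {d : ℕ} (f : E d → ℝ) : Prop := ∃ ε R : ℝ, 0 < ε ∧ 0 < R ∧ T f ε R < ⊤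

/-- Condition (A): a logarithmic moment of some order `p > 1` of the distance of two independent
points with density `f` is finite. -/
def CondA {d : ℕ} (f : E d → ℝ) : Prop :=
  ∃ p : ℝ, 1 < p ∧
    ∫⁻ x : E d, ∫⁻ y : E d, ENNReal.ofReal (|Real.log (dist x y)| ^ p)
      * ENNReal.ofReal (f x) * ENNReal.ofReal (f y) < ⊤

/-- Condition (B): some version of the density is bounded. -/
def CondB {d : ℕ} (f : E d → ℝ) : Prop :=
  ∃ g : E d → ℝ, IsVersion g f ∧ ∃ M : ℝ, 0 < M ∧ ∀ x, g x ≤ M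

/-- Condition (C1): some version of the density is bounded below by a positive constant on its
support. -/
def CondC1 {d : ℕ} (f : E d → ℝ) : Prop :=
  ∃ g : E d → ℝ, IsVersion g f ∧ ∃ m : ℝ, 0 < m ∧ ∀ x ∈ supp g, m ≤ g x

/-- Some version of the density has bounded support. -/
def BoundedSupport {d : ℕ} (f : E d → ℝ) : Prop :=
  ∃ g : E d → ℝ, IsVersion g f ∧ Bornology.IsBounded (supp g)

/-- The estimates `H_N` are asymptotically unbiased: `E H_N → H(f)`, where all the expectations
and the entropy are genuine (absolutely convergent) integrals. -/
def AsympUnbiased {d : ℕ} {Ω : Type*} [MeasurableSpace Ω] (P : MeasureTheory.Measure Ω)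
    (X : ℕ → Ω → E d) (f : E d → ℝ) : Prop :=
  (∀ N : ℕ, 2 ≤ N → MeasureTheory.Integrable (estimator X N) P) ∧
  MeasureTheory.Integrable (fun x : E d => f x * Real.log (f x)) ∧
  Filter.Tendsto (fun N : ℕ => ∫ ω, estimator X N ω ∂P) Filter.atTop (nhds (entropy f))

end KL

end

/-!
Let `V_d` be the volume of the unit ball. Up to the Euler constant, the Kozachenko-Leonenko estimate
from `n + 1` points is the average of the identically distributed variables
`log (n * V_d * ρ_i ^ d)`, where `ρ_i` is the distance from the `i`-th point to its nearest
neighbour. Conditioning on that point expresses the tail of each of them as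
`∫ (1 - μ (B(x, r))) ^ n dμ(x)`, where `n * V_d * r ^ d = exp t`. By Lebesgue differentiation this
tends to `∫ exp (-f(x) * exp t) dμ(x)`, which is the tail of `log W - log f(X)` for a standard
exponential `W` independent of `X`; the expectation of the latter is `H - γ`.

Expectations converge as well because the tails are dominated by integrable functions of `t`. For
`t → -∞` the maximal averages control `μ (B(x, r))`. For `t → +∞`, the bound `n m (1 - m) ^ n ≤ 1`,
averaged over balls by Fubini's theorem, shows that a ball of radius `D` contributes at most a
multiple of `(D / r) ^ d / n` to the tail. Choosing `D = exp (t / (2 * d))` makes this decay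
exponentially, and the measure of the complement of the ball is integrable in `t` thanks to a
logarithmic moment.
-/

namespace KL

open MeasureTheory Filter Topology Set Real Metric
open scoped ENNReal

section Tails

variable {α : Type*} [MeasurableSpace α] {P : Measure α} {Z : α → ℝ}

theorem lintegral_ofReal_eq_lintegral_meas_lt (hZ : Measurable Z) :
    ∫⁻ a, ENNReal.ofReal (Z a) ∂P = ∫⁻ t in Ioi 0, P {a | t < Z a} := by
  have h := lintegral_eq_lintegral_meas_lt (f := fun a => max (Z a) 0) P
    (ae_of_all _ fun a => le_max_right _ _) (hZ.max measurable_const).aemeasurable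
  simp only [ENNReal.ofReal_max, ENNReal.ofReal_zero, max_eq_left zero_le] at h
  rw [h]
  refine setLIntegral_congr_fun measurableSet_Ioi fun t ht => ?_
  simp only [lt_max_iff, (not_lt_of_gt ht : ¬ t < 0), or_false]

theorem lintegral_ofReal_neg_eq_lintegral_meas_le (hZ : Measurable Z) :
    ∫⁻ a, ENNReal.ofReal (-Z a) ∂P = ∫⁻ t in Ioi 0, P {a | Z a ≤ -t} := by
  have h := lintegral_eq_lintegral_meas_le (f := fun a => max (-Z a) 0) P
    (ae_of_all _ fun a => le_max_right _ _) (hZ.neg.max measurable_const).aemeasurable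
  simp only [ENNReal.ofReal_max, ENNReal.ofReal_zero, max_eq_left zero_le] at h
  rw [h]
  refine setLIntegral_congr_fun measurableSet_Ioi fun t ht => ?_
  simp only [le_max_iff, (not_le_of_gt ht : ¬ t ≤ 0), or_false, le_neg]

theorem integrable_of_lintegral_tails_ne_top (hZ : Measurable Z)
    (hpos : ∫⁻ t in Ioi 0, P {a | t < Z a} ≠ ⊤) (hneg : ∫⁻ t in Ioi 0, P {a | Z a ≤ -t} ≠ ⊤) :
    Integrable Z P := by
  rw [← lintegral_ofReal_eq_lintegral_meas_lt hZ] at hpos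
  rw [← lintegral_ofReal_neg_eq_lintegral_meas_le hZ] at hneg
  refine ⟨hZ.aestronglyMeasurable, (hasFiniteIntegral_iff_norm Z).2 ?_⟩
  calc ∫⁻ a, ENNReal.ofReal ‖Z a‖ ∂P
      ≤ ∫⁻ a, (ENNReal.ofReal (Z a) + ENNReal.ofReal (-Z a)) ∂P :=
        lintegral_mono fun a => by
          rw [Real.norm_eq_abs, abs, ENNReal.ofReal_max]
          exact max_le_add_of_nonneg zero_le zero_le
    _ = ∫⁻ a, ENNReal.ofReal (Z a) ∂P + ∫⁻ a, ENNReal.ofReal (-Z a) ∂P :=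
        lintegral_add_left hZ.ennreal_ofReal _
    _ < ⊤ := ENNReal.add_lt_top.2 ⟨hpos.lt_top, hneg.lt_top⟩

theorem integral_eq_lintegral_tails (hZ : Measurable Z) (hi : Integrable Z P) :
    ∫ a, Z a ∂P = (∫⁻ t in Ioi 0, P {a | t < Z a}).toReal -
      (∫⁻ t in Ioi 0, P {a | Z a ≤ -t}).toReal := by
  rw [integral_eq_lintegral_pos_part_sub_lintegral_neg_part hi,
    lintegral_ofReal_eq_lintegral_meas_lt hZ, lintegral_ofReal_neg_eq_lintegral_meas_le hZ]

theorem measurable_meas_lt : Measurable fun t => P {a | t < Z a} :=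
  Antitone.measurable fun _ _ h => measure_mono fun _ ha => lt_of_le_of_lt h ha

theorem measurable_meas_le_neg : Measurable fun t => P {a | Z a ≤ -t} :=
  Antitone.measurable fun _ _ h => measure_mono fun _ ha => le_trans ha (neg_le_neg h)

theorem meas_le_eq_one_sub [IsProbabilityMeasure P] (hZ : Measurable Z) (t : ℝ) :
    P {a | Z a ≤ t} = 1 - P {a | t < Z a} := by
  rw [← prob_compl_eq_one_sub (measurableSet_lt measurable_const hZ)]
  simp only [compl_ofPred, not_lt]

theorem tendsto_integral_of_dominated_tails {ι : Type*} {l : Filter ι} [l.NeBot]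
    [l.IsCountablyGenerated] {β : ι → Type*} [∀ i, MeasurableSpace (β i)]
    {ρ : ∀ i, Measure (β i)} [∀ i, IsProbabilityMeasure (ρ i)] [IsProbabilityMeasure P]
    {Y : ∀ i, β i → ℝ} (hY : ∀ i, Measurable (Y i)) (hZ : Measurable Z) {u v : ℝ → ℝ≥0∞}
    (hu : ∫⁻ t in Ioi 0, u t ≠ ⊤) (hv : ∫⁻ t in Ioi 0, v t ≠ ⊤)
    (hYu : ∀ᶠ i in l, ∀ t > 0, ρ i {b | t < Y i b} ≤ u t)
    (hYv : ∀ᶠ i in l, ∀ t > 0, ρ i {b | Y i b ≤ -t} ≤ v t)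
    (hlim : ∀ t, Tendsto (fun i => ρ i {b | t < Y i b}) l (𝓝 (P {a | t < Z a}))) :
    Integrable Z P ∧ Tendsto (fun i => ∫ b, Y i b ∂ρ i) l (𝓝 (∫ a, Z a ∂P)) := by
  have hlim' (t : ℝ) : Tendsto (fun i => ρ i {b | Y i b ≤ -t}) l (𝓝 (P {a | Z a ≤ -t})) := by
    simp only [meas_le_eq_one_sub (hY _), meas_le_eq_one_sub hZ]
    exact ENNReal.Tendsto.sub tendsto_const_nhds (hlim (-t)) (Or.inl ENNReal.one_ne_top)
  have hZu : ∫⁻ t in Ioi 0, P {a | t < Z a} ≠ ⊤ :=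
    ne_top_of_le_ne_top hu <| setLIntegral_mono' measurableSet_Ioi fun t ht =>
      le_of_tendsto (hlim t) (hYu.mono fun i hi => hi t ht)
  have hZv : ∫⁻ t in Ioi 0, P {a | Z a ≤ -t} ≠ ⊤ :=
    ne_top_of_le_ne_top hv <| setLIntegral_mono' measurableSet_Ioi fun t ht =>
      le_of_tendsto (hlim' t) (hYv.mono fun i hi => hi t ht)
  have hZi : Integrable Z P := integrable_of_lintegral_tails_ne_top hZ hZu hZv
  have hpos : Tendsto (fun i => ∫⁻ t in Ioi 0, ρ i {b | t < Y i b}) l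
      (𝓝 (∫⁻ t in Ioi 0, P {a | t < Z a})) :=
    tendsto_lintegral_filter_of_dominated_convergence u (.of_forall fun _ => measurable_meas_lt)
      (hYu.mono fun i hi => (ae_restrict_mem measurableSet_Ioi).mono hi) hu
      (ae_of_all _ hlim)
  have hneg : Tendsto (fun i => ∫⁻ t in Ioi 0, ρ i {b | Y i b ≤ -t}) l
      (𝓝 (∫⁻ t in Ioi 0, P {a | Z a ≤ -t})) :=
    tendsto_lintegral_filter_of_dominated_convergence v
      (.of_forall fun _ => measurable_meas_le_neg)
      (hYv.mono fun i hi => (ae_restrict_mem measurableSet_Ioi).mono hi) hv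
      (ae_of_all _ hlim')
  refine ⟨hZi, ?_⟩
  rw [integral_eq_lintegral_tails hZ hZi]
  refine (((ENNReal.tendsto_toReal hZu).comp hpos).sub
    ((ENNReal.tendsto_toReal hZv).comp hneg)).congr' ?_
  filter_upwards [hYu, hYv] with i hi hi'
  refine (integral_eq_lintegral_tails (hY i) (integrable_of_lintegral_tails_ne_top (hY i)
    (ne_top_of_le_ne_top hu ?_) (ne_top_of_le_ne_top hv ?_))).symm
  · exact setLIntegral_mono' measurableSet_Ioi hi
  · exact setLIntegral_mono' measurableSet_Ioi hi'

end Tails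

section BinomialBounds

theorem one_le_one_sub_pow_add_nat_mul (n : ℕ) (m : ℝ≥0∞) : 1 ≤ (1 - m) ^ n + n * m := by
  induction n with
  | zero => simp
  | succ n ih =>
    calc 1 ≤ (1 - m) ^ n * 1 + n * m := by rwa [mul_one]
      _ ≤ (1 - m) ^ n * (1 - m + m) + n * m := by gcongr; exact le_tsub_add
      _ ≤ (1 - m) ^ n * (1 - m) + 1 * m + n * m := by
          rw [mul_add]
          gcongr
          exact pow_le_one₀ zero_le tsub_le_self
      _ = (1 - m) ^ (n + 1) + (n + 1 : ℕ) * m := by push_cast; ring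

theorem one_sub_one_sub_pow_le_rpow (n : ℕ) (m : ℝ≥0∞) {δ : ℝ} (hδ : 0 < δ) (hδ' : δ ≤ 1) :
    1 - (1 - m) ^ n ≤ (n * m) ^ δ := by
  rcases le_total 1 (n * m) with h | h
  · exact tsub_le_self.trans (ENNReal.one_le_rpow h hδ)
  · calc 1 - (1 - m) ^ n ≤ n * m :=
          tsub_le_iff_left.2 (one_le_one_sub_pow_add_nat_mul n m)
      _ = (n * m) ^ (1 : ℝ) := (ENNReal.rpow_one _).symm
      _ ≤ (n * m) ^ δ := ENNReal.rpow_le_rpow_of_exponent_ge h hδ'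

theorem one_add_mul_one_sub_le_one (m : ℝ≥0∞) : (1 + m) * (1 - m) ≤ 1 := by
  calc (1 + m) * (1 - m) = (1 - m) + m * (1 - m) := by rw [add_mul, one_mul]
    _ ≤ 1 := ?_
  rcases le_total m 1 with h | h
  · calc 1 - m + m * (1 - m) ≤ 1 - m + m * 1 := by gcongr; exact tsub_le_self
      _ = 1 := by rw [mul_one, tsub_add_cancel_of_le h]
  · simp [tsub_eq_zero_of_le h]

theorem nat_mul_mul_one_sub_pow_le_one (n : ℕ) (m : ℝ≥0∞) : n * (m * (1 - m) ^ n) ≤ 1 :=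
  calc n * (m * (1 - m) ^ n) = (n * m) * (1 - m) ^ n := (mul_assoc _ _ _).symm
    _ ≤ (1 + m) ^ n * (1 - m) ^ n := by
        gcongr
        refine le_trans ?_ (one_add_mul_le_pow_of_sq_nonneg (a := m) ?_ ?_ ?_ n) <;> simp
    _ ≤ 1 := by
        rw [← mul_pow]
        exact pow_le_one₀ zero_le (one_add_mul_one_sub_le_one m)

theorem tendsto_one_sub_pow_exp {p : ℕ → ℝ≥0∞} (hp : ∀ n, p n ≤ 1) {c : ℝ}
    (h : Tendsto (fun n => n * p n) atTop (𝓝 (ENNReal.ofReal c))) (hc : 0 ≤ c) :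
    Tendsto (fun n => (1 - p n) ^ n) atTop (𝓝 (ENNReal.ofReal (exp (-c)))) := by
  have hreal : Tendsto (fun n : ℕ => (n : ℝ) * -(p n).toReal) atTop (𝓝 (-c)) := by
    simpa [ENNReal.toReal_ofReal hc, Function.comp_def] using
      ((ENNReal.tendsto_toReal ENNReal.ofReal_ne_top).comp h).neg
  refine (ENNReal.tendsto_ofReal (tendsto_one_add_pow_exp_of_tendsto hreal)).congr fun n => ?_
  rw [← sub_eq_add_neg, ENNReal.ofReal_pow
      (sub_nonneg.2 (ENNReal.toReal_le_of_le_ofReal one_pos.le (by simpa using hp n))),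
    ENNReal.ofReal_sub _ ENNReal.toReal_nonneg, ENNReal.ofReal_one,
    ENNReal.ofReal_toReal (ne_top_of_le_ne_top ENNReal.one_ne_top (hp n))]

end BinomialBounds

section Isolation

variable {α : Type*} [PseudoMetricSpace α] [MeasurableSpace α] [OpensMeasurableSpace α]

/-- The probability that a point of law `μ` has none of `n` further points within distance `r`, all
these points being independent of law `μ`. It is the tail of the nearest-neighbour distance. -/
noncomputable def isolProb (μ : Measure α) (n : ℕ) (r : ℝ) : ℝ≥0∞ :=
  ∫⁻ x, (1 - μ (closedBall x r)) ^ n ∂μ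

theorem isolProb_two_mul_le_two_mul_measure_compl (μ : Measure α) [IsProbabilityMeasure μ] {n : ℕ}
    (hn : n ≠ 0) (y : α) (s : ℝ) : isolProb μ n (2 * s) ≤ 2 * μ (closedBall y s)ᶜ := by
  have hin : ∀ x ∈ closedBall y s, (1 - μ (closedBall x (2 * s))) ^ n ≤ μ (closedBall y s)ᶜ := by
    intro x hx
    rw [prob_compl_eq_one_sub measurableSet_closedBall]
    refine (pow_le_of_le_one zero_le tsub_le_self hn).trans
      (tsub_le_tsub_left (measure_mono (closedBall_subset_closedBall' ?_)) 1)
    linarith [mem_closedBall'.1 hx]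
  rw [isolProb, ← lintegral_add_compl _ (measurableSet_closedBall (x := y) (ε := s)),
    two_mul (μ _)]
  gcongr
  · calc ∫⁻ x in closedBall y s, (1 - μ (closedBall x (2 * s))) ^ n ∂μ
        ≤ ∫⁻ _ in closedBall y s, μ (closedBall y s)ᶜ ∂μ :=
          setLIntegral_mono' measurableSet_closedBall hin
      _ ≤ μ (closedBall y s)ᶜ := by
          rw [setLIntegral_const]
          exact mul_le_of_le_one_right' prob_le_one
  · calc ∫⁻ x in (closedBall y s)ᶜ, (1 - μ (closedBall x (2 * s))) ^ n ∂μ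
        ≤ ∫⁻ _ in (closedBall y s)ᶜ, 1 ∂μ :=
          lintegral_mono fun x => pow_le_one₀ zero_le tsub_le_self
      _ = μ (closedBall y s)ᶜ := setLIntegral_one _

theorem measure_closedBall_mul_one_sub_pow_le (μ ν : Measure α) (n : ℕ) (x : α) (s : ℝ) :
    ν (closedBall x s) * (1 - μ (closedBall x (2 * s))) ^ n ≤
      ∫⁻ z in closedBall x s, (1 - μ (closedBall z s)) ^ n ∂ν := by
  rw [mul_comm, ← setLIntegral_const]
  refine setLIntegral_mono' measurableSet_closedBall fun z hz => ?_
  refine pow_le_pow_left₀ zero_le (tsub_le_tsub_left (measure_mono ?_) 1) n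
  exact closedBall_subset_closedBall' (by linarith [mem_closedBall.1 hz])

variable [SecondCountableTopology α]

theorem measurable_one_sub_measure_closedBall_pow (μ : Measure α) [SFinite μ] (n : ℕ) (r : ℝ) :
    Measurable fun x => (1 - μ (closedBall x r)) ^ n := by
  have hS : MeasurableSet {p : α × α | dist p.2 p.1 ≤ r} :=
    measurableSet_le (by fun_prop) measurable_const
  exact (measurable_const.sub (measurable_measure_prodMk_left hS)).pow_const n

theorem one_sub_isolProb_le_lintegral_rpow (μ : Measure α) [IsProbabilityMeasure μ] (n : ℕ) (r : ℝ)
    {δ : ℝ} (hδ : 0 < δ) (hδ' : δ ≤ 1) :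
    1 - isolProb μ n r ≤ ∫⁻ x, (n * μ (closedBall x r)) ^ δ ∂μ :=
  calc 1 - isolProb μ n r = ∫⁻ _, 1 ∂μ - ∫⁻ x, (1 - μ (closedBall x r)) ^ n ∂μ := by
        simp only [isolProb, lintegral_one, measure_univ]
    _ ≤ ∫⁻ x, (1 - (1 - μ (closedBall x r)) ^ n) ∂μ :=
        lintegral_sub_le _ _ (measurable_one_sub_measure_closedBall_pow μ n r)
    _ ≤ ∫⁻ x, (n * μ (closedBall x r)) ^ δ ∂μ :=
        lintegral_mono fun _ => one_sub_one_sub_pow_le_rpow n _ hδ hδ'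

theorem lintegral_setLIntegral_closedBall_swap (μ ν : Measure α) [SFinite μ] [SFinite ν] (s : ℝ)
    {g : α → ℝ≥0∞} (hg : Measurable g) :
    ∫⁻ x, ∫⁻ z in closedBall x s, g z ∂ν ∂μ = ∫⁻ z, μ (closedBall z s) * g z ∂ν := by
  set F : α × α → ℝ≥0∞ := {p | dist p.2 p.1 ≤ s}.indicator fun p => g p.2
  have hF : Measurable F := (hg.comp measurable_snd).indicator
    (measurableSet_le (by fun_prop) measurable_const)
  calc ∫⁻ x, ∫⁻ z in closedBall x s, g z ∂ν ∂μ = ∫⁻ x, ∫⁻ z, F (x, z) ∂ν ∂μ := by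
        refine lintegral_congr fun x => ?_
        rw [← lintegral_indicator measurableSet_closedBall]
        rfl
    _ = ∫⁻ z, ∫⁻ x, F (x, z) ∂μ ∂ν :=
        lintegral_lintegral_swap (f := fun x z => F (x, z)) hF.aemeasurable
    _ = ∫⁻ z, μ (closedBall z s) * g z ∂ν := by
        refine lintegral_congr fun z => ?_
        rw [mul_comm, ← setLIntegral_const, ← lintegral_indicator measurableSet_closedBall]
        simp only [F, indicator, mem_ofPred_eq, mem_closedBall, dist_comm]

theorem nat_mul_setLIntegral_closedBall_le (μ ν : Measure α) [IsProbabilityMeasure μ] [SFinite ν]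
    (n : ℕ) (y : α) (D s : ℝ) :
    n * ∫⁻ x in closedBall y D, ∫⁻ z in closedBall x s, (1 - μ (closedBall z s)) ^ n ∂ν ∂μ ≤
      ν (closedBall y (D + s)) := by
  have hmeas := measurable_one_sub_measure_closedBall_pow μ n s
  rw [lintegral_setLIntegral_closedBall_swap _ _ s hmeas,
    ← lintegral_const_mul' _ _ (ENNReal.natCast_ne_top n),
    ← lintegral_indicator_one measurableSet_closedBall]
  refine lintegral_mono fun z => ?_
  by_cases hz : z ∈ closedBall y (D + s)
  · rw [indicator_of_mem hz]
    refine le_trans ?_ (nat_mul_mul_one_sub_pow_le_one n (μ (closedBall z s)))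
    gcongr
    exact Measure.restrict_le_self
  · have hdisj : closedBall z s ∩ closedBall y D = ∅ :=
      (closedBall_disjoint_closedBall (by
        rw [mem_closedBall, not_le] at hz; linarith)).inter_eq
    rw [Measure.restrict_apply measurableSet_closedBall, hdisj]
    simp

theorem isolProb_zero_radius {α : Type*} [MetricSpace α] [MeasurableSpace α] (μ : Measure α)
    [IsProbabilityMeasure μ] [NullSingletonClass μ] (n : ℕ) : isolProb μ n 0 = 1 := by
  simp [isolProb]

end Isolation

section IsolationNormed

variable {F : Type*} [NormedAddCommGroup F] [NormedSpace ℝ F] [FiniteDimensional ℝ F]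
  [MeasurableSpace F] [BorelSpace F] (μ : Measure F) [IsProbabilityMeasure μ]

theorem setLIntegral_one_sub_measure_closedBall_pow_le {n : ℕ} (hn : n ≠ 0) (y : F) {D s : ℝ}
    (hD : 0 ≤ D) (hs : 0 < s) :
    ∫⁻ x in closedBall y D, (1 - μ (closedBall x (2 * s))) ^ n ∂μ ≤
      ENNReal.ofReal (((D + s) / s) ^ Module.finrank ℝ F) / n := by
  set ν : Measure F := Measure.addHaar
  have hν : ν (closedBall y (D + s)) =
      ENNReal.ofReal (((D + s) / s) ^ Module.finrank ℝ F) * ν (closedBall 0 s) := by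
    rw [← Measure.addHaar_closedBall_mul ν y (by positivity) hs.le, div_mul_cancel₀ _ hs.ne']
  have hν0 : ν (closedBall 0 s) ≠ 0 := (measure_closedBall_pos ν 0 hs).ne'
  have hνtop : ν (closedBall 0 s) ≠ ⊤ := measure_closedBall_lt_top.ne
  rw [ENNReal.le_div_iff_mul_le (by simp [hn]) (by simp), ← ENNReal.mul_le_mul_iff_left hν0 hνtop,
    ← hν, mul_right_comm, mul_comm _ (n : ℝ≥0∞), ← lintegral_mul_const' _ _ hνtop]
  refine le_trans ?_ (nat_mul_setLIntegral_closedBall_le μ ν n y D s)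
  gcongr with x
  rw [← Measure.addHaar_closedBall_center ν x, mul_comm]
  exact measure_closedBall_mul_one_sub_pow_le μ ν n x s

theorem isolProb_le_measure_compl_add {n : ℕ} (hn : n ≠ 0) (y : F) {D r : ℝ} (hD : 0 ≤ D)
    (hr : 0 < r) :
    isolProb μ n r ≤ 2 * μ (closedBall y D)ᶜ +
      ENNReal.ofReal ((4 * D / r) ^ Module.finrank ℝ F) / n := by
  obtain ⟨s, rfl⟩ : ∃ s, r = 2 * s := ⟨r / 2, by ring⟩
  have hs : 0 < s := by linarith
  rcases le_total s D with h | h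
  · rw [isolProb, ← lintegral_add_compl _ (measurableSet_closedBall (x := y) (ε := D)), add_comm]
    gcongr
    · calc ∫⁻ x in (closedBall y D)ᶜ, (1 - μ (closedBall x (2 * s))) ^ n ∂μ
          ≤ ∫⁻ _ in (closedBall y D)ᶜ, 1 ∂μ :=
            lintegral_mono fun x => pow_le_one₀ zero_le tsub_le_self
        _ = μ (closedBall y D)ᶜ := setLIntegral_one _
        _ ≤ 2 * μ (closedBall y D)ᶜ := le_mul_of_one_le_left' one_le_two
    · refine (setLIntegral_one_sub_measure_closedBall_pow_le μ hn y hD hs).trans ?_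
      have hratio : (D + s) / s ≤ 4 * D / (2 * s) := by
        rw [div_le_div_iff₀ hs hr]
        nlinarith
      gcongr
  · calc isolProb μ n (2 * s) ≤ 2 * μ (closedBall y s)ᶜ :=
          isolProb_two_mul_le_two_mul_measure_compl μ hn y s
      _ ≤ 2 * μ (closedBall y D)ᶜ := by gcongr
      _ ≤ _ := le_self_add

end IsolationNormed

section LogMoment

theorem ofReal_posLog (s : ℝ) : ENNReal.ofReal (log⁺ s) = ENNReal.ofReal (log s) := by
  rw [posLog, ENNReal.ofReal_max, ENNReal.ofReal_zero, max_eq_right zero_le]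

variable {F : Type*} [NormedAddCommGroup F] [MeasurableSpace F]

/-- A measure has a finite logarithmic moment when `log⁺ ‖x‖` is integrable. It bounds
the mass far from the origin, hence the upper tails of the nearest-neighbour distances. -/
def FiniteLogMoment (μ : Measure F) : Prop :=
  ∫⁻ x, ENNReal.ofReal (log⁺ ‖x‖) ∂μ ≠ ⊤

theorem FiniteLogMoment.lintegral_measure_compl_closedBall_ne_top [OpensMeasurableSpace F]
    {μ : Measure F} (hμ : FiniteLogMoment μ) {c : ℝ} (hc : 0 < c) :
    ∫⁻ t in Ioi 0, μ (closedBall 0 (exp (c * t)))ᶜ ≠ ⊤ := by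
  have hmeas : Measurable fun x : F => c⁻¹ * log⁺ ‖x‖ :=
    (measurable_const.max (measurable_log.comp measurable_norm)).const_mul _
  have htail : ∫⁻ t in Ioi 0, μ (closedBall 0 (exp (c * t)))ᶜ =
      ∫⁻ t in Ioi 0, μ {x | t < c⁻¹ * log⁺ ‖x‖} := by
    refine setLIntegral_congr_fun measurableSet_Ioi fun t (ht : 0 < t) => congrArg μ ?_
    ext x
    rw [mem_compl_iff, mem_closedBall_zero_iff, not_le, mem_ofPred_eq, lt_inv_mul_iff₀ hc, posLog,
      lt_max_iff, or_iff_right (by simp only [not_lt]; positivity)]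
    rcases (norm_nonneg x).eq_or_lt with h | h
    · simp only [← h, log_zero]
      exact iff_of_false (exp_pos _).not_gt (mul_pos hc ht).not_gt
    · rw [lt_log_iff_exp_lt h]
  rw [htail, ← lintegral_ofReal_eq_lintegral_meas_lt hmeas]
  simp only [ENNReal.ofReal_mul (inv_nonneg.2 hc.le)]
  rw [lintegral_const_mul' _ _ ENNReal.ofReal_ne_top]
  exact ENNReal.mul_ne_top ENNReal.ofReal_ne_top hμ

theorem finiteLogMoment_of_lintegral_comp_log_dist_ne_top {μ : Measure F} [IsFiniteMeasure μ]
    {ψ : ℝ → ℝ} {C : ℝ} (hψ : ∀ s, s ≤ C + ψ s) {x₀ : F}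
    (h : ∫⁻ y, ENNReal.ofReal (ψ (log (dist x₀ y))) ∂μ ≠ ⊤) : FiniteLogMoment μ := by
  have hle (y : F) : ENNReal.ofReal (log⁺ ‖y‖) ≤
      ENNReal.ofReal (log⁺ ‖x₀‖ + log 2) + ENNReal.ofReal C +
        ENNReal.ofReal (ψ (log (dist x₀ y))) := by
    have hsplit : log⁺ ‖y‖ ≤ (log⁺ ‖x₀‖ + log 2) + log⁺ (dist x₀ y) := by
      have := posLog_norm_add_le x₀ (y - x₀)
      rw [add_sub_cancel, ← dist_eq_norm, dist_comm] at this
      linarith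
    calc ENNReal.ofReal (log⁺ ‖y‖)
        ≤ ENNReal.ofReal (log⁺ ‖x₀‖ + log 2) + ENNReal.ofReal (log⁺ (dist x₀ y)) :=
          (ENNReal.ofReal_le_ofReal hsplit).trans ENNReal.ofReal_add_le
      _ = ENNReal.ofReal (log⁺ ‖x₀‖ + log 2) + ENNReal.ofReal (log (dist x₀ y)) := by
          rw [ofReal_posLog]
      _ ≤ _ := by
          rw [add_assoc]
          gcongr
          exact (ENNReal.ofReal_le_ofReal (hψ _)).trans ENNReal.ofReal_add_le
  refine ne_top_of_le_ne_top ?_ (lintegral_mono hle)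
  rw [lintegral_add_left measurable_const, lintegral_const]
  finiteness

end LogMoment

section Density

variable {d : ℕ} {f : E d → ℝ}

theorem IsProbDensity.lintegral_law (hf : IsProbDensity f) (g : E d → ℝ≥0∞) :
    ∫⁻ x, g x ∂law f = ∫⁻ x, g x * ENNReal.ofReal (f x) := by
  rw [law, lintegral_withDensity_eq_lintegral_mul_non_measurable _ hf.measurable.ennreal_ofReal
    (ae_of_all _ fun _ => ENNReal.ofReal_lt_top)]
  simp only [Pi.mul_apply, mul_comm]

theorem law_absolutelyContinuous (f : E d → ℝ) : law f ≪ volume :=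
  withDensity_absolutelyContinuous _ _

theorem law_closedBall (f : E d → ℝ) (x : E d) (r : ℝ) :
    law f (closedBall x r) = ∫⁻ y in closedBall x r, ENNReal.ofReal (f y) :=
  withDensity_apply _ measurableSet_closedBall

theorem IsProbDensity.isProbabilityMeasure_law (hf : IsProbDensity f) :
    IsProbabilityMeasure (law f) :=
  ⟨by rw [law, withDensity_apply _ .univ, Measure.restrict_univ, hf.lintegral_eq_one]⟩

theorem nullSingletonClass_law (hd : 0 < d) (f : E d → ℝ) : NullSingletonClass (law f) := by
  have : Nonempty (Fin d) := ⟨⟨0, hd⟩⟩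
  unfold law
  infer_instance

theorem IsProbDensity.ae_law_pos (hf : IsProbDensity f) : ∀ᵐ x ∂law f, 0 < f x := by
  rw [law, ae_withDensity_iff hf.measurable.ennreal_ofReal]
  exact ae_of_all _ fun x hx => ENNReal.ofReal_pos.1 (pos_iff_ne_zero.2 hx)

theorem IsProbDensity.integrable_law_iff (hf : IsProbDensity f) {g : E d → ℝ} :
    Integrable g (law f) ↔ Integrable fun x => f x * g x := by
  rw [law, integrable_withDensity_iff_integrable_smul' hf.measurable.ennreal_ofReal
    (ae_of_all _ fun _ => ENNReal.ofReal_lt_top)]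
  simp only [ENNReal.toReal_ofReal (hf.nonneg _), smul_eq_mul]

theorem IsProbDensity.entropy_eq (hf : IsProbDensity f) :
    entropy f = -∫ x, log (f x) ∂law f := by
  rw [law, integral_withDensity_eq_integral_toReal_smul hf.measurable.ennreal_ofReal
    (ae_of_all _ fun _ => ENNReal.ofReal_lt_top)]
  simp only [ENNReal.toReal_ofReal (hf.nonneg _), smul_eq_mul, entropy]

theorem unitBallVol_pos (d : ℕ) : 0 < unitBallVol d :=
  div_pos (rpow_pos_of_pos pi_pos _) (Gamma_pos_of_pos (by positivity))

theorem volume_closedBall_eq (hd : 0 < d) (x : E d) {r : ℝ} (hr : 0 ≤ r) :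
    volume (closedBall x r) = ENNReal.ofReal (r ^ d * unitBallVol d) := by
  have : Nonempty (Fin d) := ⟨⟨0, hd⟩⟩
  have hpi : √π ^ d = π ^ ((d : ℝ) / 2) := by
    rw [sqrt_eq_rpow, ← rpow_natCast, ← rpow_mul pi_pos.le]
    ring_nf
  rw [EuclideanSpace.volume_closedBall, ENNReal.ofReal_mul (by positivity), ENNReal.ofReal_pow hr,
    Fintype.card_fin, hpi, unitBallVol]

theorem law_closedBall_le_maxAvg_mul (f : E d → ℝ) (x : E d) {r R : ℝ} (hr : 0 < r) (hrR : r ≤ R) :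
    law f (closedBall x r) ≤ maxAvg f x R * ENNReal.ofReal (r ^ d * unitBallVol d) := by
  have hvol : 0 < r ^ d * unitBallVol d := mul_pos (pow_pos hr d) (unitBallVol_pos d)
  rw [← ENNReal.div_le_iff (ENNReal.ofReal_pos.2 hvol).ne' ENNReal.ofReal_ne_top, law_closedBall]
  exact le_iSup₂_of_le r ⟨hr, hrR⟩ le_rfl

theorem FiniteQ.exists_le_one (hf : IsProbDensity f) (hQ : FiniteQ f) :
    ∃ ε R : ℝ, 0 < ε ∧ ε ≤ 1 ∧ 0 < R ∧ Q f ε R < ⊤ := by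
  obtain ⟨ε, R, hε, hR, hQ⟩ := hQ
  have := hf.isProbabilityMeasure_law
  refine ⟨min ε 1, R, lt_min hε one_pos, min_le_right _ _, hR, ?_⟩
  have hle (a : ℝ≥0∞) : a ^ min ε 1 ≤ 1 + a ^ ε := by
    rcases le_total a 1 with h | h
    · exact (ENNReal.rpow_le_one h (lt_min hε one_pos).le).trans le_self_add
    · exact (ENNReal.rpow_le_rpow_of_exponent_le h (min_le_left _ _)).trans le_add_self
  calc Q f (min ε 1) R = ∫⁻ x, maxAvg f x R ^ min ε 1 ∂law f := (hf.lintegral_law _).symm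
    _ ≤ ∫⁻ x, (1 + maxAvg f x R ^ ε) ∂law f := lintegral_mono fun x => hle _
    _ = 1 + Q f ε R := by
        rw [lintegral_add_left measurable_const, hf.lintegral_law fun x => maxAvg f x R ^ ε, Q]
        simp
    _ < ⊤ := ENNReal.add_lt_top.2 ⟨ENNReal.one_lt_top, hQ⟩

end Density

section SufficientConditions

variable {d : ℕ} {f : E d → ℝ}

theorem finiteQ_of_condB (hd : 0 < d) (hf : IsProbDensity f) (hB : CondB f) : FiniteQ f := by
  have := hf.isProbabilityMeasure_law
  obtain ⟨g, hg, M, -, hM⟩ := hB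
  have hball (x : E d) (r : ℝ) (hr : 0 < r) : ballAvg f x r ≤ ENNReal.ofReal M := by
    rw [ballAvg, ← volume_closedBall_eq hd x hr.le]
    refine ENNReal.div_le_of_le_mul ?_
    rw [← setLIntegral_const]
    refine lintegral_mono_ae (ae_restrict_of_ae ?_)
    filter_upwards [hg] with y hy
    exact ENNReal.ofReal_le_ofReal (hy ▸ hM y)
  refine ⟨1, 1, one_pos, one_pos, ?_⟩
  calc Q f 1 1 = ∫⁻ x, maxAvg f x 1 ^ (1 : ℝ) ∂law f := (hf.lintegral_law _).symm
    _ ≤ ∫⁻ _, ENNReal.ofReal M ∂law f := lintegral_mono fun x => by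
        rw [ENNReal.rpow_one]
        exact iSup₂_le fun r hr => hball x r hr.1
    _ < ⊤ := by simp

theorem exists_ne_top_of_lintegral_ne_top {α : Type*} [MeasurableSpace α] {μ : Measure α}
    [IsProbabilityMeasure μ] {g : α → ℝ≥0∞} (h : ∫⁻ x, g x ∂μ ≠ ⊤) : ∃ x, g x ≠ ⊤ := by
  by_contra! htop
  simp [htop] at h

theorem finiteLogMoment_law_of_condA (hf : IsProbDensity f) (hA : CondA f) :
    FiniteLogMoment (law f) := by
  have := hf.isProbabilityMeasure_law
  obtain ⟨p, hp, hA⟩ := hA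
  have hmoment : ∫⁻ x, ∫⁻ y, ENNReal.ofReal (|log (dist x y)| ^ p) ∂law f ∂law f ≠ ⊤ := by
    convert hA.ne using 1
    rw [hf.lintegral_law]
    refine lintegral_congr fun x => ?_
    rw [hf.lintegral_law, ← lintegral_mul_const' _ _ ENNReal.ofReal_ne_top]
    simp only [mul_right_comm]
  have hψ (s : ℝ) : s ≤ 1 + |s| ^ p := by
    rcases le_total |s| 1 with h | h
    · linarith [le_abs_self s, rpow_nonneg (abs_nonneg s) p]
    · linarith [le_abs_self s, self_le_rpow_of_one_le h hp.le]
  obtain ⟨x, hx⟩ := exists_ne_top_of_lintegral_ne_top hmoment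
  exact finiteLogMoment_of_lintegral_comp_log_dist_ne_top hψ hx

theorem le_exp_one_add_G_abs (s : ℝ) : s ≤ exp 1 + G |s| := by
  have hs := le_abs_self s
  unfold G
  split_ifs with h
  · linarith [one_le_exp zero_le_one]
  · rw [not_lt] at h
    rcases le_total |s| (exp 1) with he | he
    · linarith [mul_nonneg (abs_nonneg s) (log_nonneg h)]
    · have hlog : 1 ≤ log |s| := (le_log_iff_exp_le (by linarith)).2 he
      nlinarith [exp_pos 1]

theorem finiteLogMoment_law_of_finiteK (hf : IsProbDensity f) (hK : FiniteK f) :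
    FiniteLogMoment (law f) := by
  have := hf.isProbabilityMeasure_law
  obtain ⟨ε, hε, hK⟩ := hK
  have hmoment :
      ∫⁻ x, (∫⁻ y, ENNReal.ofReal (G |log (dist x y)|) ∂law f) ^ (1 + ε) ∂law f ≠ ⊤ := by
    simpa only [hf.lintegral_law, K] using hK.ne
  obtain ⟨x, hx⟩ := exists_ne_top_of_lintegral_ne_top hmoment
  refine finiteLogMoment_of_lintegral_comp_log_dist_ne_top le_exp_one_add_G_abs (x₀ := x) ?_
  contrapose! hx
  rw [hx, ENNReal.top_rpow_of_pos (by linarith)]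

theorem finiteLogMoment_law_of_boundedSupport (hf : IsProbDensity f) (hS : BoundedSupport f) :
    FiniteLogMoment (law f) := by
  have := hf.isProbabilityMeasure_law
  obtain ⟨g, hg, hS⟩ := hS
  obtain ⟨C, hC⟩ := hS.exists_norm_le
  have hle : ∀ᵐ x ∂law f, ENNReal.ofReal (log⁺ ‖x‖) ≤ ENNReal.ofReal (log⁺ C) := by
    filter_upwards [hf.ae_law_pos, (law_absolutelyContinuous f).ae_le hg] with x hpos hx
    have hx' : x ∈ supp g := hpos.trans_eq hx.symm
    exact ENNReal.ofReal_le_ofReal (posLog_le_posLog (norm_nonneg x) (hC x hx'))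
  refine ne_top_of_le_ne_top ?_ (lintegral_mono_ae hle)
  simp

end SufficientConditions

section NearestNeighbour

variable {d n : ℕ}

theorem lt_nnDist_iff (hn : n ≠ 0) (x : Fin (n + 1) → E d) (i : Fin (n + 1)) (r : ℝ) :
    r < nnDist x i ↔ ∀ k : Fin n, r < dist (x (i.succAbove k)) (x i) := by
  have : Nonempty {j : Fin (n + 1) // j ≠ i} :=
    ⟨⟨i.succAbove ⟨0, Nat.pos_of_ne_zero hn⟩, Fin.succAbove_ne _ _⟩⟩
  rw [nnDist, iInf, (finite_range _).lt_csInf_iff (range_nonempty _), forall_mem_range,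
    Subtype.forall, Fin.forall_iff_succAbove i]
  simp [dist_comm, Fin.succAbove_ne]

theorem measurable_nnDist {N : ℕ} (i : Fin N) : Measurable fun x : Fin N → E d => nnDist x i :=
  .iInf fun j => by fun_prop

theorem pi_lt_nnDist (hn : n ≠ 0) (μ : Measure (E d)) [IsProbabilityMeasure μ] (i : Fin (n + 1))
    (r : ℝ) : Measure.pi (fun _ : Fin (n + 1) => μ) {x | r < nnDist x i} = isolProb μ n r := by
  set S : Set (E d × (Fin n → E d)) := {p | ∀ k, r < dist (p.2 k) p.1}
  have hS : MeasurableSet S := by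
    simp only [S, ofPred_forall]
    exact .iInter fun k => measurableSet_lt measurable_const (by fun_prop)
  have hpre : {x : Fin (n + 1) → E d | r < nnDist x i} =
      MeasurableEquiv.piFinSuccAbove (fun _ => E d) i ⁻¹' S :=
    Set.ext fun x => lt_nnDist_iff hn x i r
  have hsection (x : E d) : Prod.mk x ⁻¹' S = univ.pi fun _ : Fin n => (closedBall x r)ᶜ := by
    ext y
    simp [S]
  rw [hpre, (measurePreserving_piFinSuccAbove (fun _ => μ) i).measure_preimage hS.nullMeasurableSet,
    Measure.prod_apply hS, isolProb]
  simp [hsection, prob_compl_eq_one_sub measurableSet_closedBall]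

theorem ae_pi_nnDist_pos (hn : n ≠ 0) (μ : Measure (E d)) [IsProbabilityMeasure μ]
    [NullSingletonClass μ] : ∀ᵐ x ∂Measure.pi fun _ : Fin (n + 1) => μ, ∀ i, 0 < nnDist x i := by
  refine ae_all_iff.2 fun i => (mem_ae_iff_prob_eq_one
    (measurableSet_lt measurable_const (measurable_nnDist i))).2 ?_
  rw [pi_lt_nnDist hn, isolProb_zero_radius]

/-- The log-spacing of the sample point `x i`: the logarithm of the volume of the largest ball
around it free of the `n` other points, scaled by `n`. The Kozachenko-Leonenko estimate is an
average of log-spacings. -/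
noncomputable def logSpacing (x : Fin (n + 1) → E d) (i : Fin (n + 1)) : ℝ :=
  log (n * unitBallVol d * nnDist x i ^ d)

/-- The radius `r` with `n * unitBallVol d * r ^ d = exp t`, at which the nearest-neighbour
distance makes the log-spacing equal to `t`. -/
noncomputable def spacingRadius (d n : ℕ) (t : ℝ) : ℝ := (exp t / (n * unitBallVol d)) ^ (d : ℝ)⁻¹

theorem spacingRadius_pos (d : ℕ) (hn : n ≠ 0) (t : ℝ) : 0 < spacingRadius d n t := by
  have := unitBallVol_pos d
  unfold spacingRadius
  positivity

theorem mul_spacingRadius_pow (hd : 0 < d) (hn : n ≠ 0) (t : ℝ) :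
    n * unitBallVol d * spacingRadius d n t ^ d = exp t := by
  have := unitBallVol_pos d
  rw [spacingRadius, rpow_inv_natCast_pow (by positivity) hd.ne']
  field_simp

theorem tendsto_spacingRadius (hd : 0 < d) (t : ℝ) :
    Tendsto (fun n => spacingRadius d n t) atTop (𝓝[>] 0) := by
  refine tendsto_nhdsWithin_iff.2 ⟨?_, (eventually_ne_atTop 0).mono fun n hn =>
    spacingRadius_pos d hn t⟩
  have hlim : Tendsto (fun n : ℕ => exp t / (n * unitBallVol d)) atTop (𝓝 0) :=
    tendsto_const_nhds.div_atTop
      (tendsto_natCast_atTop_atTop.atTop_mul_const (unitBallVol_pos d))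
  have hexp : (0 : ℝ) < (d : ℝ)⁻¹ := by positivity
  simpa only [spacingRadius, zero_rpow hexp.ne'] using hlim.rpow_const (Or.inr hexp.le)

theorem measurable_logSpacing (i : Fin (n + 1)) :
    Measurable fun x : Fin (n + 1) → E d => logSpacing x i :=
  measurable_log.comp (((measurable_nnDist i).pow_const d).const_mul _)

theorem lt_logSpacing_iff (hd : 0 < d) (hn : n ≠ 0) {x : Fin (n + 1) → E d} {i : Fin (n + 1)}
    (hx : 0 < nnDist x i) (t : ℝ) : t < logSpacing x i ↔ spacingRadius d n t < nnDist x i := by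
  have hscale : 0 < n * unitBallVol d :=
    mul_pos (by exact_mod_cast Nat.pos_of_ne_zero hn) (unitBallVol_pos d)
  rw [logSpacing, lt_log_iff_exp_lt (by positivity), ← mul_spacingRadius_pow hd hn,
    mul_lt_mul_iff_right₀ hscale,
    pow_lt_pow_iff_left₀ (spacingRadius_pos d hn t).le hx.le hd.ne']

theorem pi_lt_logSpacing (hd : 0 < d) (hn : n ≠ 0) (μ : Measure (E d)) [IsProbabilityMeasure μ]
    [NullSingletonClass μ] (i : Fin (n + 1)) (t : ℝ) :
    Measure.pi (fun _ : Fin (n + 1) => μ) {x | t < logSpacing x i} =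
      isolProb μ n (spacingRadius d n t) := by
  rw [← pi_lt_nnDist hn μ i]
  refine measure_congr ((ae_pi_nnDist_pos hn μ).mono fun x hx => propext ?_)
  exact lt_logSpacing_iff hd hn (hx i) t

theorem identDistrib_logSpacing (hd : 0 < d) (hn : n ≠ 0) (μ : Measure (E d))
    [IsProbabilityMeasure μ] [NullSingletonClass μ] (i j : Fin (n + 1)) :
    ProbabilityTheory.IdentDistrib (fun x : Fin (n + 1) → E d => logSpacing x i)
      (fun x => logSpacing x j) (Measure.pi fun _ => μ) (Measure.pi fun _ => μ) where
  aemeasurable_fst := (measurable_logSpacing i).aemeasurable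
  aemeasurable_snd := (measurable_logSpacing j).aemeasurable
  map_eq := by
    have := Measure.isProbabilityMeasure_map (μ := Measure.pi fun _ : Fin (n + 1) => μ)
      (measurable_logSpacing i).aemeasurable
    refine Measure.ext_of_Iic _ _ fun t => ?_
    rw [Measure.map_apply (measurable_logSpacing i) measurableSet_Iic,
      Measure.map_apply (measurable_logSpacing j) measurableSet_Iic]
    change Measure.pi _ {x | logSpacing x i ≤ t} = Measure.pi _ {x | logSpacing x j ≤ t}
    simp only [meas_le_eq_one_sub (measurable_logSpacing _), pi_lt_logSpacing hd hn]

theorem estimate_eq_of_nnDist_pos (hn : n ≠ 0) {x : Fin (n + 1) → E d}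
    (hx : ∀ i, 0 < nnDist x i) :
    estimate x = (∑ i, logSpacing x i) / (n + 1) + eulerConst := by
  have hV := unitBallVol_pos d
  have hlog (i : Fin (n + 1)) :
      logSpacing x i = log n + log (unitBallVol d) + d * log (nnDist x i) := by
    rw [logSpacing, log_mul (by positivity) (pow_pos (hx i) d).ne', log_mul (by positivity) hV.ne',
      log_pow]
  rw [estimate, meanDist, log_rpow (Finset.prod_pos fun i _ => hx i),
    log_prod fun i _ => (hx i).ne']
  simp only [hlog, Finset.sum_add_distrib, ← Finset.mul_sum, Finset.sum_const, Finset.card_univ,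
    Fintype.card_fin, nsmul_eq_mul, Nat.cast_add, Nat.cast_one, add_sub_cancel_right]
  field_simp
  ring

theorem ae_estimate_eq (hn : n ≠ 0) (μ : Measure (E d)) [IsProbabilityMeasure μ]
    [NullSingletonClass μ] : (fun x : Fin (n + 1) → E d => estimate x) =ᵐ[Measure.pi fun _ => μ]
      fun x => (∑ i, logSpacing x i) / (n + 1) + eulerConst :=
  (ae_pi_nnDist_pos hn μ).mono fun _ hx => estimate_eq_of_nnDist_pos hn hx

theorem integrable_estimate (hd : 0 < d) (hn : n ≠ 0) {μ : Measure (E d)} [IsProbabilityMeasure μ]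
    [NullSingletonClass μ]
    (hi : Integrable (fun x : Fin (n + 1) → E d => logSpacing x 0) (Measure.pi fun _ => μ)) :
    Integrable (fun x : Fin (n + 1) → E d => estimate x) (Measure.pi fun _ => μ) := by
  have hall (i : Fin (n + 1)) := (identDistrib_logSpacing hd hn μ i 0).integrable_iff.2 hi
  exact (((integrable_finsetSum _ fun i _ => hall i).div_const _).add
    (integrable_const _)).congr (ae_estimate_eq hn μ).symm

theorem integral_estimate (hd : 0 < d) (hn : n ≠ 0) {μ : Measure (E d)} [IsProbabilityMeasure μ]
    [NullSingletonClass μ]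
    (hi : Integrable (fun x : Fin (n + 1) → E d => logSpacing x 0) (Measure.pi fun _ => μ)) :
    ∫ x : Fin (n + 1) → E d, estimate x ∂(Measure.pi fun _ => μ) =
      ∫ x : Fin (n + 1) → E d, logSpacing x 0 ∂(Measure.pi fun _ => μ) + eulerConst := by
  have hall (i : Fin (n + 1)) := (identDistrib_logSpacing hd hn μ i 0).integrable_iff.2 hi
  rw [integral_congr_ae (ae_estimate_eq hn μ),
    integral_add ((integrable_finsetSum _ fun i _ => hall i).div_const _) (integrable_const _),
    integral_div, integral_finsetSum _ fun i _ => hall i]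
  simp only [(identDistrib_logSpacing hd hn μ _ 0).integral_eq, Finset.sum_const, Finset.card_univ,
    Fintype.card_fin, nsmul_eq_mul, Nat.cast_add, Nat.cast_one, integral_const, probReal_univ,
    one_smul]
  field_simp

end NearestNeighbour

section TailBounds

variable {d : ℕ}

theorem lintegral_Ioi_ofReal_exp_neg_mul_ne_top {c : ℝ} (hc : 0 < c) :
    ∫⁻ t in Ioi (0 : ℝ), ENNReal.ofReal (exp (-c * t)) ≠ ⊤ :=
  (integrableOn_exp_mul_Ioi (neg_lt_zero.2 hc) 0).lintegral_lt_top.ne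

theorem isolProb_spacingRadius_le (hd : 0 < d) {n : ℕ} (hn : n ≠ 0) (μ : Measure (E d))
    [IsProbabilityMeasure μ] (t : ℝ) :
    isolProb μ n (spacingRadius d n t) ≤ 2 * μ (closedBall 0 (exp ((2 * d : ℝ)⁻¹ * t)))ᶜ +
      ENNReal.ofReal (4 ^ d * unitBallVol d) * ENNReal.ofReal (exp (-2⁻¹ * t)) := by
  set D := exp ((2 * d : ℝ)⁻¹ * t)
  set r := spacingRadius d n t
  have hV := unitBallVol_pos d
  have hr : 0 < r := spacingRadius_pos d hn t
  have hDpow : D ^ d = exp (2⁻¹ * t) := by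
    rw [← exp_nat_mul]
    field_simp
  have hratio : (4 * D / r) ^ d = n * (4 ^ d * unitBallVol d * exp (-2⁻¹ * t)) :=
    calc (4 * D / r) ^ d = 4 ^ d * exp (2⁻¹ * t) / r ^ d := by rw [div_pow, mul_pow, hDpow]
      _ = n * (4 ^ d * unitBallVol d * exp (2⁻¹ * t)) / (n * unitBallVol d * r ^ d) := by
          field_simp
      _ = n * (4 ^ d * unitBallVol d * exp (-2⁻¹ * t)) := by
          rw [mul_spacingRadius_pow hd hn, mul_div_assoc, mul_div_assoc, ← exp_sub]
          ring_nf
  refine (isolProb_le_measure_compl_add μ hn 0 (D := D) (exp_pos _).le hr).trans_eq ?_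
  rw [finrank_euclideanSpace_fin, hratio, ENNReal.ofReal_mul (by positivity),
    ENNReal.ofReal_natCast, mul_comm (n : ℝ≥0∞), ENNReal.mul_div_cancel_right (by simpa) (by simp),
    ENNReal.ofReal_mul (by positivity)]

theorem exists_lintegral_ne_top_forall_isolProb_le (hd : 0 < d) {μ : Measure (E d)}
    [IsProbabilityMeasure μ] (hμ : FiniteLogMoment μ) :
    ∃ u : ℝ → ℝ≥0∞, ∫⁻ t in Ioi 0, u t ≠ ⊤ ∧
      ∀ n ≠ 0, ∀ t, isolProb μ n (spacingRadius d n t) ≤ u t := by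
  refine ⟨_, ?_, fun n hn => isolProb_spacingRadius_le hd hn μ⟩
  rw [lintegral_add_right _ (by fun_prop), lintegral_const_mul' _ _ ENNReal.ofNat_ne_top,
    lintegral_const_mul' _ _ ENNReal.ofReal_ne_top]
  have hball := hμ.lintegral_measure_compl_closedBall_ne_top (c := (2 * d : ℝ)⁻¹) (by positivity)
  have hexp := lintegral_Ioi_ofReal_exp_neg_mul_ne_top (c := 2⁻¹) (by norm_num)
  finiteness

variable {f : E d → ℝ}

theorem IsProbDensity.one_sub_isolProb_le (hf : IsProbDensity f) {ε R : ℝ} (hε : 0 < ε)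
    (hε' : ε ≤ 1) (n : ℕ) {r : ℝ} (hr : 0 < r) (hrR : r ≤ R) :
    1 - isolProb (law f) n r ≤
      Q f ε R * ENNReal.ofReal (n * unitBallVol d * r ^ d) ^ ε := by
  have := hf.isProbabilityMeasure_law
  calc 1 - isolProb (law f) n r ≤ ∫⁻ x, (n * law f (closedBall x r)) ^ ε ∂law f :=
        one_sub_isolProb_le_lintegral_rpow _ n r hε hε'
    _ ≤ ∫⁻ x, maxAvg f x R ^ ε * ENNReal.ofReal (n * unitBallVol d * r ^ d) ^ ε ∂law f := by
        refine lintegral_mono fun x => ?_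
        rw [← ENNReal.mul_rpow_of_nonneg _ _ hε.le, mul_assoc (n : ℝ), mul_comm (unitBallVol d),
          ENNReal.ofReal_mul (Nat.cast_nonneg n), ENNReal.ofReal_natCast, mul_left_comm]
        gcongr
        exact law_closedBall_le_maxAvg_mul f x hr hrR
    _ = Q f ε R * ENNReal.ofReal (n * unitBallVol d * r ^ d) ^ ε := by
        rw [lintegral_mul_const' _ _ (ENNReal.rpow_ne_top_of_nonneg hε.le ENNReal.ofReal_ne_top),
          hf.lintegral_law fun x => maxAvg f x R ^ ε, Q]

theorem IsProbDensity.one_sub_isolProb_spacingRadius_le (hd : 0 < d) (hf : IsProbDensity f)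
    {ε R : ℝ} (hε : 0 < ε) (hε' : ε ≤ 1) (hR : 0 < R) {n : ℕ} (hn : n ≠ 0) (t : ℝ) :
    1 - isolProb (law f) n (spacingRadius d n (-t)) ≤
      (Q f ε R + ENNReal.ofReal (unitBallVol d * R ^ d)⁻¹ ^ ε) *
        ENNReal.ofReal (exp (-ε * t)) := by
  have hV := unitBallVol_pos d
  set r := spacingRadius d n (-t)
  have hr : n * unitBallVol d * r ^ d = exp (-t) := mul_spacingRadius_pow hd hn (-t)
  have hexp : ENNReal.ofReal (exp (-ε * t)) = ENNReal.ofReal (exp (-t)) ^ ε := by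
    rw [ENNReal.ofReal_rpow_of_pos (exp_pos _), ← exp_mul]
    ring_nf
  rw [hexp, add_mul]
  rcases le_total r R with h | h
  · refine le_add_of_le_left ?_
    rw [← hr]
    exact hf.one_sub_isolProb_le hε hε' n (spacingRadius_pos d hn _) h
  · have hball : 1 ≤ (unitBallVol d * R ^ d)⁻¹ * exp (-t) := by
      have hn1 : (1 : ℝ) ≤ n := by exact_mod_cast Nat.one_le_iff_ne_zero.2 hn
      rw [← hr, inv_mul_eq_div, one_le_div (by positivity), mul_assoc]
      calc unitBallVol d * R ^ d ≤ unitBallVol d * r ^ d := by gcongr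
        _ ≤ n * (unitBallVol d * r ^ d) :=
            le_mul_of_one_le_left (mul_nonneg hV.le (pow_nonneg (hR.le.trans h) d)) hn1
    refine le_add_of_le_right (tsub_le_self.trans ?_)
    rw [← ENNReal.mul_rpow_of_nonneg _ _ hε.le, ← ENNReal.ofReal_mul (by positivity)]
    exact ENNReal.one_le_rpow (ENNReal.one_le_ofReal.2 hball) hε

theorem FiniteQ.exists_lintegral_ne_top_forall_one_sub_isolProb_le (hd : 0 < d)
    (hf : IsProbDensity f) (hQ : FiniteQ f) :
    ∃ v : ℝ → ℝ≥0∞, ∫⁻ t in Ioi 0, v t ≠ ⊤ ∧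
      ∀ n ≠ 0, ∀ t, 1 - isolProb (law f) n (spacingRadius d n (-t)) ≤ v t := by
  obtain ⟨ε, R, hε, hε', hR, hQ⟩ := hQ.exists_le_one hf
  have hcoeff : Q f ε R + ENNReal.ofReal (unitBallVol d * R ^ d)⁻¹ ^ ε ≠ ⊤ :=
    ENNReal.add_ne_top.2 ⟨hQ.ne, ENNReal.rpow_ne_top_of_nonneg hε.le ENNReal.ofReal_ne_top⟩
  refine ⟨_, ?_, fun n hn => hf.one_sub_isolProb_spacingRadius_le hd hε hε' hR hn⟩
  rw [lintegral_const_mul' _ _ hcoeff]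
  exact ENNReal.mul_ne_top hcoeff (lintegral_Ioi_ofReal_exp_neg_mul_ne_top hε)

end TailBounds

section ExponentialLaw

open ProbabilityTheory

theorem expMeasure_eq_withDensity (r : ℝ) : expMeasure r =
    (volume.restrict (Ioi 0)).withDensity fun w => ENNReal.ofReal (r * exp (-(r * w))) := by
  rw [← withDensity_indicator measurableSet_Ioi]
  refine withDensity_congr_ae ((Measure.ae_ne volume 0).mono fun w hw => ?_)
  change exponentialPDF r w = _
  rcases hw.lt_or_gt with h | h
  · rw [exponentialPDF_of_neg h, indicator_of_notMem (notMem_Ioi.2 h.le)]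
  · rw [exponentialPDF_of_nonneg h.le, indicator_of_mem (mem_Ioi.2 h)]

theorem expMeasure_Ioi {r c : ℝ} (hr : 0 < r) (hc : 0 ≤ c) :
    expMeasure r (Ioi c) = ENNReal.ofReal (exp (-(r * c))) := by
  have := isProbabilityMeasure_expMeasure hr
  have hexp : exp (-(r * c)) ≤ 1 := exp_le_one_iff.2 (neg_nonpos.2 (by positivity))
  rw [← compl_Iic, prob_compl_eq_one_sub measurableSet_Iic, ← ofReal_cdf, cdf_expMeasure_eq hr,
    if_pos hc, ← ENNReal.ofReal_one, ← ENNReal.ofReal_sub _ (sub_nonneg.2 hexp), sub_sub_cancel]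

theorem ae_expMeasure_pos {r : ℝ} (hr : 0 < r) : ∀ᵐ w ∂expMeasure r, 0 < w := by
  have := isProbabilityMeasure_expMeasure hr
  refine (mem_ae_iff_prob_eq_one measurableSet_Ioi).2 ?_
  rw [expMeasure_Ioi hr le_rfl, mul_zero, neg_zero, exp_zero, ENNReal.ofReal_one]

theorem integral_log_expMeasure_one : ∫ w, log w ∂expMeasure 1 = -eulerConst := by
  rw [expMeasure_eq_withDensity,
    integral_withDensity_eq_integral_toReal_smul (by fun_prop)
      (ae_of_all _ fun _ => ENNReal.ofReal_lt_top)]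
  simp only [one_mul, ENNReal.toReal_ofReal (exp_pos _).le, smul_eq_mul, eulerConst, neg_neg]

end ExponentialLaw

section Limit

open ProbabilityTheory

variable {d : ℕ} {f : E d → ℝ}

theorem IsProbDensity.ae_tendsto_nat_mul_law_closedBall (hd : 0 < d) (hf : IsProbDensity f) :
    ∀ᵐ x ∂law f, ∀ t, Tendsto (fun n : ℕ => n * law f (closedBall x (spacingRadius d n t))) atTop
      (𝓝 (ENNReal.ofReal (f x * exp t))) := by
  have := hf.isProbabilityMeasure_law
  have hac := (law_absolutelyContinuous f).ae_le
  filter_upwards [hac (Besicovitch.ae_tendsto_rnDeriv (law f) volume),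
    hac (Measure.rnDeriv_withDensity volume hf.measurable.ennreal_ofReal)] with x hx hderiv t
  rw [show (law f).rnDeriv volume x = ENNReal.ofReal (f x) from hderiv] at hx
  rw [ENNReal.ofReal_mul (hf.nonneg x)]
  refine (ENNReal.Tendsto.mul_const (hx.comp (tendsto_spacingRadius hd t))
    (Or.inr ENNReal.ofReal_ne_top)).congr' ?_
  filter_upwards [eventually_ne_atTop 0] with n hn
  have hr := spacingRadius_pos d hn t
  have hvol : 0 < spacingRadius d n t ^ d * unitBallVol d := mul_pos (pow_pos hr d)
    (unitBallVol_pos d)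
  rw [Function.comp_apply, volume_closedBall_eq hd x hr.le, ← mul_spacingRadius_pow hd hn t,
    mul_assoc, mul_comm (unitBallVol d), ENNReal.ofReal_mul (Nat.cast_nonneg n),
    ENNReal.ofReal_natCast, mul_left_comm,
    ENNReal.div_mul_cancel (ENNReal.ofReal_pos.2 hvol).ne' ENNReal.ofReal_ne_top]

theorem IsProbDensity.tendsto_isolProb_spacingRadius (hd : 0 < d) (hf : IsProbDensity f) (t : ℝ) :
    Tendsto (fun n => isolProb (law f) n (spacingRadius d n t)) atTop
      (𝓝 (∫⁻ x, ENNReal.ofReal (exp (-(f x * exp t))) ∂law f)) := by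
  have := hf.isProbabilityMeasure_law
  refine tendsto_lintegral_of_dominated_convergence (fun _ => 1)
    (fun n => measurable_one_sub_measure_closedBall_pow _ n _)
    (fun n => ae_of_all _ fun x => pow_le_one₀ zero_le tsub_le_self) (by simp) ?_
  filter_upwards [hf.ae_tendsto_nat_mul_law_closedBall hd] with x hx
  exact tendsto_one_sub_pow_exp (fun n => prob_le_one) (hx t)
    (mul_nonneg (hf.nonneg x) (exp_pos t).le)

/-- The limit of the log-spacings: the logarithm of an exponential waiting time `p.2` run at the
rate `f p.1`, to be taken under the product law `(law f).prod (expMeasure 1)`. -/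
noncomputable def limitSpacing (f : E d → ℝ) (p : E d × ℝ) : ℝ := log p.2 - log (f p.1)

theorem IsProbDensity.measurable_limitSpacing (hf : IsProbDensity f) :
    Measurable (limitSpacing f) :=
  (measurable_log.comp measurable_snd).sub
    (measurable_log.comp (hf.measurable.comp measurable_fst))

theorem IsProbDensity.prod_lt_limitSpacing (hf : IsProbDensity f) (t : ℝ) :
    ((law f).prod (expMeasure 1)) {p | t < limitSpacing f p} =
      ∫⁻ x, ENNReal.ofReal (exp (-(f x * exp t))) ∂law f := by
  have := isProbabilityMeasure_expMeasure one_pos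
  rw [Measure.prod_apply (measurableSet_lt measurable_const hf.measurable_limitSpacing)]
  refine lintegral_congr_ae (hf.ae_law_pos.mono fun x hx => ?_)
  have hsection : Prod.mk x ⁻¹' {p | t < limitSpacing f p} =ᵐ[expMeasure 1] Ioi (f x * exp t) := by
    filter_upwards [ae_expMeasure_pos one_pos] with w hw
    refine propext ?_
    change t < log w - log (f x) ↔ f x * exp t < w
    rw [lt_sub_iff_add_lt', lt_log_iff_exp_lt hw, exp_add, exp_log hx]
  exact (measure_congr hsection).trans (by
    rw [expMeasure_Ioi one_pos (mul_pos hx (exp_pos t)).le, one_mul])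

theorem IsProbDensity.integrable_log_of_integrable_limitSpacing (hf : IsProbDensity f)
    (hi : Integrable (limitSpacing f) ((law f).prod (expMeasure 1))) :
    Integrable (fun x => log (f x)) (law f) := by
  have := hf.isProbabilityMeasure_law
  have := isProbabilityMeasure_expMeasure one_pos
  obtain ⟨w, hw⟩ := hi.prod_left_ae.exists
  exact ((integrable_const (log w)).sub hw).congr (ae_of_all _ fun x => sub_sub_cancel _ _)

theorem IsProbDensity.integral_limitSpacing (hf : IsProbDensity f)
    (hi : Integrable (limitSpacing f) ((law f).prod (expMeasure 1))) :
    ∫ p, limitSpacing f p ∂((law f).prod (expMeasure 1)) = entropy f - eulerConst := by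
  have := hf.isProbabilityMeasure_law
  have := isProbabilityMeasure_expMeasure one_pos
  have hfst : Integrable (fun p : E d × ℝ => log (f p.1)) ((law f).prod (expMeasure 1)) :=
    (hf.integrable_log_of_integrable_limitSpacing hi).comp_fst _
  have hsnd : Integrable (fun p : E d × ℝ => log p.2) ((law f).prod (expMeasure 1)) :=
    (hi.add hfst).congr (ae_of_all _ fun p => sub_add_cancel _ _)
  simp only [limitSpacing]
  rw [integral_sub hsnd hfst, integral_fun_snd log, integral_fun_fst fun x => log (f x),
    integral_log_expMeasure_one, hf.entropy_eq]
  simp only [probReal_univ, one_smul]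
  ring

end Limit

section Unbiased

open ProbabilityTheory

variable {d : ℕ} {f : E d → ℝ}

theorem IsProbDensity.exists_lintegral_ne_top_forall_tails_logSpacing_le (hd : 0 < d)
    (hf : IsProbDensity f) (hlog : FiniteLogMoment (law f)) (hQ : FiniteQ f) :
    ∃ u v : ℝ → ℝ≥0∞, ∫⁻ t in Ioi 0, u t ≠ ⊤ ∧ ∫⁻ t in Ioi 0, v t ≠ ⊤ ∧ ∀ n ≠ 0, ∀ t,
      Measure.pi (fun _ : Fin (n + 1) => law f) {x | t < logSpacing x 0} ≤ u t ∧
      Measure.pi (fun _ : Fin (n + 1) => law f) {x | logSpacing x 0 ≤ -t} ≤ v t := by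
  have := hf.isProbabilityMeasure_law
  have := nullSingletonClass_law hd f
  obtain ⟨u, hu, hle⟩ := exists_lintegral_ne_top_forall_isolProb_le hd hlog
  obtain ⟨v, hv, hle'⟩ := hQ.exists_lintegral_ne_top_forall_one_sub_isolProb_le hd hf
  refine ⟨u, v, hu, hv, fun n hn t => ?_⟩
  rw [meas_le_eq_one_sub (measurable_logSpacing 0), pi_lt_logSpacing hd hn,
    pi_lt_logSpacing hd hn]
  exact ⟨hle n hn t, hle' n hn t⟩

theorem IsProbDensity.integrable_logSpacing (hd : 0 < d) (hf : IsProbDensity f)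
    (hlog : FiniteLogMoment (law f)) (hQ : FiniteQ f) {n : ℕ} (hn : n ≠ 0) :
    Integrable (fun x : Fin (n + 1) → E d => logSpacing x 0) (Measure.pi fun _ => law f) := by
  obtain ⟨u, v, hu, hv, hle⟩ := hf.exists_lintegral_ne_top_forall_tails_logSpacing_le hd hlog hQ
  exact integrable_of_lintegral_tails_ne_top (measurable_logSpacing 0)
    (ne_top_of_le_ne_top hu (lintegral_mono fun t => (hle n hn t).1))
    (ne_top_of_le_ne_top hv (lintegral_mono fun t => (hle n hn t).2))

theorem IsProbDensity.tendsto_integral_logSpacing (hd : 0 < d) (hf : IsProbDensity f)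
    (hlog : FiniteLogMoment (law f)) (hQ : FiniteQ f) :
    Integrable (fun x => log (f x)) (law f) ∧
      Tendsto (fun n => ∫ x : Fin (n + 1) → E d, logSpacing x 0 ∂(Measure.pi fun _ => law f)) atTop
        (𝓝 (entropy f - eulerConst)) := by
  have := hf.isProbabilityMeasure_law
  have := nullSingletonClass_law hd f
  have := isProbabilityMeasure_expMeasure one_pos
  obtain ⟨u, v, hu, hv, hle⟩ := hf.exists_lintegral_ne_top_forall_tails_logSpacing_le hd hlog hQ
  have hlim (t : ℝ) : Tendsto
      (fun n : ℕ => Measure.pi (fun _ : Fin (n + 1) => law f) {x | t < logSpacing x 0}) atTop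
      (𝓝 (((law f).prod (expMeasure 1)) {p | t < limitSpacing f p})) := by
    rw [hf.prod_lt_limitSpacing]
    refine (hf.tendsto_isolProb_spacingRadius hd t).congr' ?_
    filter_upwards [eventually_ne_atTop 0] with n hn
    rw [pi_lt_logSpacing hd hn]
  obtain ⟨hi, htendsto⟩ := tendsto_integral_of_dominated_tails
    (fun n => measurable_logSpacing (n := n) 0) hf.measurable_limitSpacing hu hv
    ((eventually_ne_atTop 0).mono fun n hn t _ => (hle n hn t).1)
    ((eventually_ne_atTop 0).mono fun n hn t _ => (hle n hn t).2) hlim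
  rw [hf.integral_limitSpacing hi] at htendsto
  exact ⟨hf.integrable_log_of_integrable_limitSpacing hi, htendsto⟩

variable {Ω : Type*} [MeasurableSpace Ω] {P : Measure Ω} [IsProbabilityMeasure P]

theorem map_sample_eq_pi {α : Type*} [MeasurableSpace α] {X : ℕ → Ω → α} {μ : Measure α}
    (hX : ∀ i, Measurable (X i)) (hindep : iIndepFun X P) (hlaw : ∀ i, P.map (X i) = μ) (N : ℕ) :
    P.map (fun ω (i : Fin N) => X i ω) = Measure.pi fun _ => μ := by
  have hsample := hindep.precomp (g := fun i : Fin N => (i : ℕ)) Fin.val_injective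
  simpa only [hlaw] using
    (iIndepFun_iff_map_fun_eq_pi_map fun i : Fin N => (hX i).aemeasurable).1 hsample

theorem integrable_estimator_and_integral_estimator {X : ℕ → Ω → E d}
    {μ : Measure (E d)} [IsProbabilityMeasure μ] [NullSingletonClass μ] (hd : 0 < d)
    (hX : ∀ i, Measurable (X i)) (hindep : iIndepFun X P) (hlaw : ∀ i, P.map (X i) = μ)
    {n : ℕ} (hn : n ≠ 0)
    (hi : Integrable (fun x : Fin (n + 1) → E d => logSpacing x 0) (Measure.pi fun _ => μ)) :
    Integrable (estimator X (n + 1)) P ∧ ∫ ω, estimator X (n + 1) ω ∂P =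
      ∫ x : Fin (n + 1) → E d, logSpacing x 0 ∂(Measure.pi fun _ => μ) + eulerConst := by
  have hsample : Measurable fun ω (i : Fin (n + 1)) => X i ω :=
    measurable_pi_lambda _ fun i => hX i
  have hest := integrable_estimate hd hn hi
  rw [← integral_estimate hd hn hi]
  rw [← map_sample_eq_pi hX hindep hlaw] at hest ⊢
  exact ⟨hest.comp_measurable hsample,
    (integral_map hsample.aemeasurable hest.aestronglyMeasurable).symm⟩

end Unbiased

end KL

theorem corollary2_general {d : ℕ} (hd : 0 < d) {Ω : Type*} [MeasurableSpace Ω]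
    (P : MeasureTheory.Measure Ω) [MeasureTheory.IsProbabilityMeasure P]
    (f : KL.E d → ℝ) (hf : KL.IsProbDensity f)
    (X : ℕ → Ω → KL.E d) (hX : ∀ i, Measurable (X i))
    (hindep : ProbabilityTheory.iIndepFun X P)
    (hlaw : ∀ i, P.map (X i) = KL.law f)
    (hlog : KL.FiniteLogMoment (KL.law f)) (hQ : KL.FiniteQ f) : KL.AsympUnbiased P X f := by
  have := hf.isProbabilityMeasure_law
  have := KL.nullSingletonClass_law hd f
  obtain ⟨hentropy, hlim⟩ := hf.tendsto_integral_logSpacing hd hlog hQ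
  have hest (n : ℕ) (hn : n ≠ 0) := KL.integrable_estimator_and_integral_estimator hd hX hindep
    hlaw hn (hf.integrable_logSpacing hd hlog hQ hn)
  refine ⟨fun N hN => ?_, hf.integrable_law_iff.1 hentropy, ?_⟩
  · obtain ⟨n, rfl⟩ := Nat.exists_eq_add_of_le' (one_le_two.trans hN)
    exact (hest n (by lia)).1
  · refine (Filter.tendsto_add_atTop_iff_nat 1).1 ?_
    rw [← sub_add_cancel (KL.entropy f) KL.eulerConst]
    refine (hlim.add_const KL.eulerConst).congr' ?_
    filter_upwards [Filter.eventually_ne_atTop 0] with n hn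
    exact (hest n hn).2.symm

theorem corollary2 {d : ℕ} (hd : 0 < d) {Ω : Type*} [MeasurableSpace Ω]
    (P : MeasureTheory.Measure Ω) [MeasureTheory.IsProbabilityMeasure P]
    (f : KL.E d → ℝ) (hf : KL.IsProbDensity f)
    (X : ℕ → Ω → KL.E d) (hX : ∀ i, Measurable (X i))
    (hindep : ProbabilityTheory.iIndepFun X P)
    (hlaw : ∀ i, P.map (X i) = KL.law f) :
    ((KL.FiniteK f ∨ KL.CondA f) → (KL.FiniteQ f ∨ KL.CondB f) →
        (KL.FiniteT f ∨ KL.CondC1 f) → KL.AsympUnbiased P X f) ∧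
    (KL.CondB f → KL.CondC1 f → KL.BoundedSupport f → KL.AsympUnbiased P X f) := by
  have hunbiased := corollary2_general hd P f hf X hX hindep hlaw
  exact ⟨fun hK hQ _ => hunbiased
      (hK.elim (KL.finiteLogMoment_law_of_finiteK hf) (KL.finiteLogMoment_law_of_condA hf))
      (hQ.elim id (KL.finiteQ_of_condB hd hf)),
    fun hB _ hS => hunbiased (KL.finiteLogMoment_law_of_boundedSupport hf hS)
      (KL.finiteQ_of_condB hd hf hB)⟩
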